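/- Incidence geometries are triples $(P,L,I)$ with $I\subseteq P\times L$; the dual of $(P,L,I)$ is $(L,P,I^{-1})$. A linear space is an incidence geometry in which any two distinct points are incident with exactly one line and each line is incident with at least two points. A unital of order $q>1$ is a $2$-$(q^3+1,q+1,1)$ design, i.e. an incidence geometry with $q^3+1$ points and exactly $q+1$ points on each block, in which any two distinct points are incident with exactly one block. A geometry contains another one if there are injective maps from the points and from the lines of the latter to the points and to the lines (blocks) of the former, respectively, that preserve incidence. Let $\mathbb{U}$ be a unital of order $q>2$. Then $\mathbb{U}$ does not contain the dual of any linear space that has exactly $q^2$ points and in which each line has at most $q+1$ points. In particular, $\mathbb{U}$ contains neither the dual of an affine plane of order $q$ nor a projective plane of order $q$. -/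

import Mathlib

/-!
An incidence geometry is a triple `(P, L, I)` of a type `P` of points, a type `L` of lines (or
blocks) and an incidence relation `I : P → L → Prop`. Its dual is `(L, P, flip I)`.
-/

/-- A linear space: any two distinct points are incident with exactly one line, and each line is
incident with at least two points. -/
structure IsLinearSpace {P L : Type*} (I : P → L → Prop) : Prop where
  existsUnique_line : ∀ p p' : P, p ≠ p' → ∃! l : L, I p l ∧ I p' l
  exists_two_points : ∀ l : L, ∃ p p' : P, p ≠ p' ∧ I p l ∧ I p' l

/-- A unital of order `q > 1`: a `2`-`(q ^ 3 + 1, q + 1, 1)` design. -/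
structure IsUnital {U B : Type*} (I : U → B → Prop) (q : ℕ) : Prop where
  one_lt : 1 < q
  card_points : Nat.card U = q ^ 3 + 1
  card_block : ∀ b : B, {u : U | I u b}.ncard = q + 1
  existsUnique_block : ∀ u u' : U, u ≠ u' → ∃! b : B, I u b ∧ I u' b

/-- An affine plane: a linear space with three non-collinear points that satisfies the parallel
axiom. -/
structure IsAffinePlane {P L : Type*} (I : P → L → Prop) : Prop extends IsLinearSpace I where
  existsUnique_parallel : ∀ (p : P) (l : L), ¬ I p l → ∃! m : L, I p m ∧ ∀ x : P, ¬ (I x l ∧ I x m)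
  exists_triangle : ∃ a b c : P, a ≠ b ∧ a ≠ c ∧ b ≠ c ∧ ∀ l : L, ¬ (I a l ∧ I b l ∧ I c l)

/-- An affine plane of order `q`: each line has exactly `q` points. -/
structure IsAffinePlaneOfOrder {P L : Type*} (I : P → L → Prop) (q : ℕ) : Prop
    extends IsAffinePlane I where
  card_line : ∀ l : L, {p : P | I p l}.Finite ∧ {p : P | I p l}.ncard = q

/-- The geometry with incidence relation `I` is contained in the one with incidence relation `J`:
points can be mapped injectively to points and lines injectively to lines in such a way that
incidence is preserved. (Non-incidence need not be preserved, so that this is the weakest notion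
of containment, and denying it is the strongest form of a non-containment claim.) -/
def IsContainedIn {P L P' L' : Type*} (I : P → L → Prop) (J : P' → L' → Prop) : Prop :=
  ∃ (f : P → P') (g : L → L'), Function.Injective f ∧ Function.Injective g ∧
    ∀ (p : P) (l : L), I p l → J (f p) (g l)

open Finset

/-! Dually, `q ^ 2` points of the linear space become a set `S` of `q ^ 2` pairwise intersecting
blocks. Such a clique is extremal: a variance computation gives every block outside `S` degree sum
exactly `q + 1` (`blockWeight_of_notMem`), so points not joined by `S` have degrees adding up to at
most `q + 1`.

The bound on line sizes gives degrees `r ≤ q + 1`. The defects `s = q + 1 - r` then add up to `q +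
1` on each block of `S`. A point `y` off `d ∈ S` has at least `s y` unjoined points on `d`, each of
defect at least `r y`; so `s y * r y ≤ q + 1`. This forces defect constantly 1 on all blocks of `S`
but at most one, and two such blocks contradict each other (`false_of_clique`). -/

section Unital

/-! ### Double counting in a unital -/

variable {U B : Type*} [Fintype U] [Fintype B] {J : U → B → Prop} {q : ℕ}

open Classical in
/-- The number of blocks of `S` through the point `u`. -/
noncomputable def blockDegree (J : U → B → Prop) (S : Finset B) (u : U) : ℕ := #{b ∈ S | J u b}

open Classical in
/-- The sum of the degrees (with respect to `S`) of the points on the block `b`. -/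
noncomputable def blockWeight (J : U → B → Prop) (S : Finset B) (b : B) : ℕ :=
  ∑ u with J u b, blockDegree J S u

omit [Fintype B] in
open Classical in
theorem sum_sum_incident (J : U → B → Prop) (S : Finset B) (w : U → ℕ) :
    ∑ b ∈ S, ∑ u with J u b, w u = ∑ u, blockDegree J S u * w u := by
  simp_rw [blockDegree, sum_filter, card_filter, sum_mul]
  rw [sum_comm]
  refine sum_congr rfl fun u _ => sum_congr rfl fun b _ => ?_
  split_ifs <;> simp

namespace IsUnital

omit [Fintype U] [Fintype B] in
theorem block_eq (hU : IsUnital J q) {u v : U} {b c : B} (huv : u ≠ v) (hub : J u b)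
    (hvb : J v b) (huc : J u c) (hvc : J v c) : b = c :=
  (hU.existsUnique_block u v huv).unique ⟨hub, hvb⟩ ⟨huc, hvc⟩

omit [Fintype B] in
open Classical in
theorem card_filter_block (hU : IsUnital J q) (b : B) : #{u | J u b} = q + 1 := by
  rw [← hU.card_block b, Set.ncard_eq_toFinset_card']
  congr 1
  ext; simp

omit [Fintype B] in
open Classical in
theorem sum_block_const (hU : IsUnital J q) (S : Finset B) :
    ∑ u, blockDegree J S u = #S * (q + 1) := by
  have h := sum_sum_incident J S (fun _ => 1)
  simp only [sum_const, hU.card_filter_block, smul_eq_mul, mul_one] at h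
  exact h.symm

-- The blocks through `u` partition the other points. The weight 1 gives the parameters of the
-- design, the weight `blockDegree` the second moment of the block weights.
open Classical in
theorem sum_pencil (hU : IsUnital J q) (w : U → ℕ) (u : U) :
    ∑ b with J u b, ∑ v with J v b, w v
      = #{b | J u b} * w u + ∑ v ∈ univ.erase u, w v := by
  rw [sum_sum_incident, ← add_sum_erase _ _ (mem_univ u)]
  congr 1
  · simp only [blockDegree, filter_filter, and_self]
  · refine sum_congr rfl fun v hv => ?_
    suffices blockDegree J {b | J u b} v = 1 by rw [this, one_mul]
    obtain ⟨b, hb, hb'⟩ := hU.existsUnique_block u v (ne_of_mem_erase hv).symm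
    rw [blockDegree, filter_filter, card_eq_one]
    refine ⟨b, ?_⟩
    ext c
    simp only [mem_filter, mem_univ, true_and, mem_singleton]
    exact ⟨hb' c, fun h => h ▸ hb⟩

open Classical in
theorem card_pencil (hU : IsUnital J q) (u : U) : #{b | J u b} = q ^ 2 := by
  have h := hU.sum_pencil (fun _ => 1) u
  have hc : Fintype.card U = q ^ 3 + 1 := by rw [← hU.card_points, Nat.card_eq_fintype_card]
  simp only [sum_const, hU.card_filter_block, smul_eq_mul, mul_one, card_erase_of_mem (mem_univ u),
    card_univ, hc, Nat.add_sub_cancel] at h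
  have hq := hU.one_lt
  have : #{b | J u b} * q = q ^ 2 * q := by linarith [pow_succ q 2]
  exact Nat.eq_of_mul_eq_mul_right (by lia) this

open Classical in
theorem card_blocks (hU : IsUnital J q) : Fintype.card B * (q + 1) = (q ^ 3 + 1) * q ^ 2 := by
  have h := hU.sum_block_const univ
  have hc : Fintype.card U = q ^ 3 + 1 := by rw [← hU.card_points, Nat.card_eq_fintype_card]
  simp only [blockDegree, hU.card_pencil, sum_const, card_univ, hc, smul_eq_mul] at h
  exact h.symm

/-! ### Cliques of `q ^ 2` blocks -/

variable {S : Finset B}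

omit [Fintype B] in
open Classical in
/-- A block meeting each of the other members of `S`. -/
theorem blockWeight_of_mem (hU : IsUnital J q)
    (hS : ∀ b ∈ S, ∀ c ∈ S, b ≠ c → ∃ u, J u b ∧ J u c) {b : B} (hb : b ∈ S) :
    blockWeight J S b = q + #S := by
  have h : blockWeight J S b = ∑ c ∈ S, #{u | J u b ∧ J u c} := by
    simp_rw [blockWeight, blockDegree, card_filter, sum_filter]
    rw [sum_comm' (t' := univ) (s' := fun _ => S) (by simp)]
    refine sum_congr rfl fun u _ => ?_
    split_ifs with hu <;> simp [hu]
  rw [h, ← add_sum_erase _ _ hb]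
  have h1 : ∑ c ∈ S.erase b, #{u | J u b ∧ J u c} = ∑ c ∈ S.erase b, 1 := by
    refine sum_congr rfl fun c hc => ?_
    obtain ⟨u, hu, hu'⟩ := hS b hb c (mem_of_mem_erase hc) (ne_of_mem_erase hc).symm
    rw [card_eq_one]
    refine ⟨u, ?_⟩
    ext v
    simp only [mem_filter, mem_univ, true_and, mem_singleton]
    refine ⟨fun hv => ?_, fun h => h ▸ ⟨hu, hu'⟩⟩
    by_contra hne
    exact ne_of_mem_erase hc (hU.block_eq hne hv.1 hu hv.2 hu').symm
  have := card_pos.2 ⟨b, hb⟩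
  rw [h1, sum_const, card_erase_of_mem hb]
  simp only [and_self, hU.card_filter_block, smul_eq_mul, mul_one]
  lia

/-- A set of `q ^ 2` pairwise intersecting blocks of a unital of order `q` attains the clique bound
of the block graph, so that every other block meets exactly `q + 1` members of it. -/
theorem blockWeight_of_notMem (hU : IsUnital J q)
    (hS : ∀ b ∈ S, ∀ c ∈ S, b ≠ c → ∃ u, J u b ∧ J u c) (hcard : #S = q ^ 2) {b : B}
    (hb : b ∉ S) : blockWeight J S b = q + 1 := by
  classical
  have hq := hU.one_lt
  have e0 : ∑ u, blockDegree J S u = q ^ 2 * (q + 1) := by rw [hU.sum_block_const, hcard]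
  have e1 : ∑ u, blockDegree J S u * blockDegree J S u = q ^ 2 * (q + q ^ 2) := by
    rw [← sum_sum_incident]
    calc _ = ∑ b ∈ S, (q + q ^ 2) := sum_congr rfl fun b hb => by
            rw [← hcard, ← hU.blockWeight_of_mem hS hb, blockWeight]
      _ = _ := by rw [sum_const, hcard, smul_eq_mul]
  have e2 : ∑ b, blockWeight J S b = q ^ 2 * (q ^ 2 * (q + 1)) := by
    simp only [blockWeight]
    rw [sum_sum_incident, ← e0, mul_sum]
    exact sum_congr rfl fun u _ => by rw [← hU.card_pencil u]; rfl
  have e3 : ∑ b, blockWeight J S b * blockWeight J S b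
      = ∑ u, blockDegree J S u * ∑ b with J u b, blockWeight J S b := by
    calc _ = ∑ b, ∑ u with J u b, blockDegree J S u * blockWeight J S b :=
          sum_congr rfl fun b _ => by rw [← sum_mul]; rfl
      _ = _ := by
        simp_rw [mul_sum, sum_filter]
        exact sum_comm
  have e4 (u : U) : ((∑ b with J u b, blockWeight J S b : ℕ) : ℤ)
      = (q ^ 2 - 1) * blockDegree J S u + q ^ 2 * (q + 1) := by
    have h1 := hU.sum_pencil (blockDegree J S) u
    have h2 := add_sum_erase univ (blockDegree J S) (mem_univ u)
    rw [e0] at h2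
    rw [hU.card_pencil] at h1
    simp only [blockWeight]
    rw [h1]
    zify at h2
    push_cast
    linarith
  have e5 : ∑ b, (blockWeight J S b : ℤ) * blockWeight J S b
      = (q ^ 2 - 1) * (q ^ 2 * (q + q ^ 2)) + q ^ 2 * (q + 1) * (q ^ 2 * (q + 1)) := by
    zify at e3 e0 e1
    push_cast at e4
    rw [e3, ← e1]
    conv_rhs => rw [← e0]
    rw [mul_sum, mul_sum, ← sum_add_distrib]
    refine sum_congr rfl fun u _ => ?_
    rw [e4, e0]
    ring
  have hcB : (Fintype.card B : ℤ) = q ^ 2 * (q ^ 2 - q + 1) := by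
    have h := hU.card_blocks
    zify at h
    have : (q : ℤ) + 1 ≠ 0 := by positivity
    apply mul_right_cancel₀ this
    rw [h]
    ring
  -- Squared deviation from the expected value `q + 1`. The members of `S` alone account for the
  -- whole total, so it vanishes on every other block.
  have e6 : ∑ b, ((blockWeight J S b : ℤ) - (q + 1)) ^ 2
      = (q : ℤ) ^ 2 * ((q : ℤ) ^ 2 - 1) ^ 2 := by
    zify at e2
    calc _ = ∑ b, ((blockWeight J S b : ℤ) * blockWeight J S b)
          - 2 * (q + 1) * ∑ b, (blockWeight J S b : ℤ) + ∑ _b : B, ((q : ℤ) + 1) ^ 2 := by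
          rw [mul_sum, ← sum_sub_distrib, ← sum_add_distrib]
          exact sum_congr rfl fun b _ => by ring
      _ = _ := by
          rw [e5, e2, sum_const, card_univ, nsmul_eq_mul, hcB]
          ring
  have e7 : ∑ b ∈ S, ((blockWeight J S b : ℤ) - (q + 1)) ^ 2
      = (q : ℤ) ^ 2 * ((q : ℤ) ^ 2 - 1) ^ 2 := by
    calc _ = ∑ b ∈ S, ((q : ℤ) ^ 2 - 1) ^ 2 := sum_congr rfl fun b hb => by
            rw [hU.blockWeight_of_mem hS hb, hcard]; push_cast; ring
      _ = _ := by rw [sum_const, hcard, nsmul_eq_mul]; push_cast; ring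
  have e8 := sum_compl_add_sum S fun b => ((blockWeight J S b : ℤ) - (q + 1)) ^ 2
  have e9 : ∑ b ∈ Sᶜ, ((blockWeight J S b : ℤ) - (q + 1)) ^ 2 = 0 := by linarith
  have := (sum_eq_zero_iff_of_nonneg fun _ _ => sq_nonneg _).1 e9 b (mem_compl.2 hb)
  have := pow_eq_zero_iff two_ne_zero |>.1 this
  zify
  linarith

/-- Two points not joined by a block of `S` have degrees adding up to at most `q + 1`. -/
theorem blockDegree_add_le (hU : IsUnital J q)
    (hS : ∀ b ∈ S, ∀ c ∈ S, b ≠ c → ∃ u, J u b ∧ J u c) (hcard : #S = q ^ 2) {u v : U}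
    (huv : u ≠ v) (h : ∀ c ∈ S, J u c → ¬ J v c) :
    blockDegree J S u + blockDegree J S v ≤ q + 1 := by
  classical
  obtain ⟨b, ⟨hu, hv⟩, -⟩ := hU.existsUnique_block u v huv
  rw [← hU.blockWeight_of_notMem hS hcard fun hb => h b hb hu hv, blockWeight, ← sum_pair huv]
  refine sum_le_sum_of_subset fun w hw => ?_
  rcases mem_insert.1 hw with rfl | hw
  · simpa using hu
  · simpa [mem_singleton.1 hw] using hv

open Classical in
/-- At least `q + 1 - r` points of a block `d` are not joined by blocks of `S` to a given point of
degree `r`. -/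
theorem le_card_not_joined (hU : IsUnital J q) {d : B} {y : U} (hy : ¬ J y d) :
    q + 1 ≤ #{u | J u d ∧ ∀ c ∈ S, J y c → ¬ J u c} + blockDegree J S y := by
  -- Since `y` is not on `d`, a block through `y` meets `d` at most once, so the joined points
  -- inject into the blocks of `S` through `y`.
  have h : #{u | J u d ∧ ¬ ∀ c ∈ S, J y c → ¬ J u c} ≤ blockDegree J S y := by
    have hex (u : U) (hu : u ∈ ({u | J u d ∧ ¬ ∀ c ∈ S, J y c → ¬ J u c} : Finset U)) :
        ∃ c ∈ S, J y c ∧ J u c := by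
      simpa using (mem_filter.1 hu).2.2
    have : Nonempty B := ⟨d⟩
    choose! g hgS hgy hgu using hex
    refine card_le_card_of_injOn g (fun u hu => ?_) fun u hu v hv huv => ?_
    · exact mem_coe.2 (mem_filter.2 ⟨hgS u hu, hgy u hu⟩)
    · by_contra hne
      have := hU.block_eq hne (mem_filter.1 hu).2.1 (mem_filter.1 hv).2.1 (hgu u hu)
        (huv ▸ hgu v hv)
      exact hy (this ▸ hgy u hu)
  rw [← hU.card_filter_block d, ← card_filter_add_card_filter_not
    (s := {u | J u d}) (p := fun u => ∀ c ∈ S, J y c → ¬ J u c), filter_filter, filter_filter]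
  lia

/-! ### Defects on a clique -/

theorem false_of_clique (hU : IsUnital J q) (hq : 2 < q)
    (hS : ∀ b ∈ S, ∀ c ∈ S, b ≠ c → ∃ u, J u b ∧ J u c) (hcard : #S = q ^ 2)
    (hr : ∀ u, blockDegree J S u ≤ q + 1) : False := by
  classical
  set r := blockDegree J S with hrdef
  obtain ⟨s, hs⟩ : ∃ s : U → ℕ, ∀ u, s u + r u = q + 1 :=
    ⟨fun u => q + 1 - r u, fun u => Nat.sub_add_cancel (hr u)⟩
  have sum_s {d : B} (hd : d ∈ S) : ∑ u with J u d, s u = q + 1 := by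
    have h1 : ∑ u with J u d, (s u + r u) = (q + 1) * (q + 1) := by
      simp only [hs, sum_const, hU.card_filter_block, smul_eq_mul]
    have h2 : ∑ u with J u d, r u = q + q ^ 2 := by
      rw [← hcard, ← hU.blockWeight_of_mem hS hd]; rfl
    rw [sum_add_distrib, h2] at h1
    linarith
  have sum_le {d : B} (hd : d ∈ S) {A : Finset U} (hA : ∀ u ∈ A, J u d) :
      ∑ u ∈ A, s u ≤ q + 1 := by
    rw [← sum_s hd]
    exact sum_le_sum_of_subset fun u hu => mem_filter.2 ⟨mem_univ u, hA u hu⟩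
  have r_pos {y : U} {a : B} (ha : a ∈ S) (hy : J y a) : 1 ≤ r y :=
    card_pos.2 ⟨a, mem_filter.2 ⟨ha, hy⟩⟩
  -- the points of `d` that are not joined to `y` by a member of `S`
  let N (y : U) (d : B) : Finset U := {u | J u d ∧ ∀ c ∈ S, J y c → ¬ J u c}
  have hN {y u : U} {d : B} : u ∈ N y d ↔ J u d ∧ ∀ c ∈ S, J y c → ¬ J u c := by simp [N]
  have card_N {y : U} {d : B} (hy : ¬ J y d) : s y ≤ #(N y d) := by
    have := hU.le_card_not_joined (S := S) hy
    have := hs y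
    simp only [N]
    lia
  have le_s {y u : U} {d : B} (hy : ¬ J y d) (hu : u ∈ N y d) : r y ≤ s u := by
    have hne : y ≠ u := fun h => hy (h ▸ (hN.1 hu).1)
    have := hU.blockDegree_add_le hS hcard hne (hN.1 hu).2
    have := hs u
    lia
  have sum_N {y : U} {d : B} (hy : ¬ J y d) {A : Finset U} (hA : A ⊆ N y d) :
      #A * r y ≤ ∑ u ∈ A, s u := by
    rw [← smul_eq_mul]
    exact card_nsmul_le_sum _ _ _ fun u hu => le_s hy (hA hu)
  -- If `s y` and `r y` are both at least 2, then `s y * r y ≤ q + 1 = s y + r y` forces both to be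
  -- 2, so `q = 3`.
  have s_mem {y : U} {a : B} (ha : a ∈ S) (hya : J y a) : s y = 0 ∨ s y = 1 ∨ s y = q := by
    by_contra! hcon
    have h1 := r_pos ha hya
    have h2 := hs y
    have key {d : B} (hd : d ∈ S) (hyd : ¬ J y d) :
        s y * r y ≤ ∑ u ∈ N y d, s u :=
      (Nat.mul_le_mul_right _ (card_N hyd)).trans (sum_N hyd subset_rfl)
    obtain ⟨d, hd, hyd⟩ : ∃ d ∈ S, ¬ J y d := by
      by_contra! hall
      have : r y = q ^ 2 := by rw [← hcard, hrdef, blockDegree, filter_true_of_mem hall]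
      nlinarith
    have h3 := (key hd hyd).trans (sum_le hd fun u hu => (hN.1 hu).1)
    obtain ⟨hs2, hr2⟩ : s y = 2 ∧ r y = 2 := by
      obtain ⟨k, hk⟩ : ∃ k, s y = k + 2 := ⟨s y - 2, by lia⟩
      obtain ⟨m, hm⟩ : ∃ m, r y = m + 2 := ⟨r y - 2, by lia⟩
      rw [hk, hm] at h3
      rw [hk, hm] at h2
      have : k = 0 := by nlinarith
      have : m = 0 := by nlinarith
      lia
    have hq3 : q = 3 := by lia
    -- On a second block `d ∈ S` through `w`, the points of `N y d` already use up the total defect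
    -- 4, and `w` is not among them.
    have hs_eq {w : U} (hw : J w a) (hwy : w ≠ y) : s w = 0 ∨ s w = 3 := by
      have hw1 := r_pos ha hw
      have hw2 := hs w
      by_cases hrw : r w = 1
      · right; lia
      left
      obtain ⟨d, hd, hda⟩ := exists_mem_ne (s := {b ∈ S | J w b})
        (show 1 < r w by lia) a
      obtain ⟨hd, hwd⟩ := mem_filter.1 hd
      have hyd : ¬ J y d := fun hyd => hda (hU.block_eq hwy hwd hyd hw hya)
      have hwN : w ∉ N y d := fun h => (hN.1 h).2 a ha hya hw
      have h4 := sum_le hd (A := insert w (N y d)) fun u hu => by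
        rcases mem_insert.1 hu with rfl | hu
        exacts [hwd, (hN.1 hu).1]
      rw [sum_insert hwN] at h4
      have := key hd hyd
      rw [hs2, hr2] at this
      lia
    -- The defect 2 left on `a` is not a sum of terms 0 and 3.
    have hmem : y ∈ ({u | J u a} : Finset U) := by simpa using hya
    have h5 := add_sum_erase _ s hmem
    rw [sum_s ha, hs2, hq3] at h5
    obtain ⟨w, hw, hw0⟩ := exists_ne_zero_of_sum_ne_zero
      (show ∑ w ∈ ({u | J u a} : Finset U).erase y, s w ≠ 0 by lia)
    have h6 := single_le_sum_of_canonicallyOrdered (f := s) hw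
    have := hs_eq (mem_filter.1 (mem_of_mem_erase hw)).2 (ne_of_mem_erase hw)
    lia
  -- Otherwise `e` carries defect `q` at `w` and at least 1 at `q - 1` other points, whence `2 * q -
  -- 1 ≤ q + 1`.
  have bad_unique {z w : U} {d e : B} (hd : d ∈ S) (he : e ∈ S) (hzd : J z d) (hwe : J w e)
      (hz : s z = q) (hw : s w = q) : d = e := by
    by_contra hne
    have hrz : r z = 1 := by have := hs z; lia
    have hze : ¬ J z e := fun hze => by
      refine hne (card_le_one.1 hrz.le d ?_ e ?_) <;> simp [*]
    have h1 := card_N hze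
    have h2 := sum_N hze (erase_subset w _)
    have h3 := pred_card_le_card_erase (s := N z e) (a := w)
    have h4 := sum_le he (A := insert w ((N z e).erase w)) fun u hu => by
      rcases mem_insert.1 hu with rfl | hu
      exacts [hwe, (hN.1 (mem_of_mem_erase hu)).1]
    rw [sum_insert (notMem_erase _ _)] at h4
    rw [hrz] at h2
    lia
  have s_eq_one {d : B} (hd : d ∈ S) (hnb : ¬ ∃ u, J u d ∧ s u = q) {u : U} (hu : J u d) :
      s u = 1 := by
    have hle : ∀ v ∈ ({u | J u d} : Finset U), s v ≤ 1 := fun v hv => by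
      have hv := (mem_filter.1 hv).2
      rcases s_mem hd hv with h | h | h
      exacts [by lia, by lia, (hnb ⟨v, hv, h⟩).elim]
    refine (sum_eq_sum_iff_of_le hle).1 ?_ u (by simpa using hu)
    rw [sum_s hd, sum_const, hU.card_filter_block, smul_eq_mul, mul_one]
  have hbad : #{d ∈ S | ∃ u, J u d ∧ s u = q} ≤ 1 := by
    refine card_le_one.2 fun d hd e he => ?_
    obtain ⟨hd, z, hz, hz'⟩ := mem_filter.1 hd
    obtain ⟨he, w, hw, hw'⟩ := mem_filter.1 he
    exact bad_unique hd he hz hw hz' hw'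
  have hgood : 1 < #{d ∈ S | ¬ ∃ u, J u d ∧ s u = q} := by
    have := card_filter_add_card_filter_not (s := S) (fun d => ∃ u, J u d ∧ s u = q)
    rw [hcard] at this
    nlinarith
  obtain ⟨d, hd, e, he, hde⟩ := one_lt_card.1 hgood
  obtain ⟨hd, hd'⟩ := mem_filter.1 hd
  obtain ⟨he, he'⟩ := mem_filter.1 he
  -- `y` has defect 1, so degree `q`; some point of `e` is not joined to it and has defect at least
  -- `q`, yet defects on `e` are 1.
  obtain ⟨y, hyd, hye⟩ : ∃ y, J y d ∧ ¬ J y e := by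
    by_contra! hall
    obtain ⟨u, hu, v, hv, huv⟩ := one_lt_card.1
      (show 1 < #{u | J u d} by rw [hU.card_filter_block]; lia)
    have hu := (mem_filter.1 hu).2
    have hv := (mem_filter.1 hv).2
    exact hde (hU.block_eq huv hu hv (hall u hu) (hall v hv))
  have hsy := s_eq_one hd hd' hyd
  obtain ⟨u, hu⟩ := card_pos.1 (show 0 < #(N y e) by have := card_N hye; lia)
  have h1 := le_s hye hu
  have h2 := s_eq_one he he' (hN.1 hu).1
  have h3 := hs y
  lia

/-! ### From containment to cliques -/

omit [Fintype U] [Fintype B] in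
theorem finite_points (hU : IsUnital J q) : Finite U :=
  Nat.finite_of_card_ne_zero (by rw [hU.card_points]; lia)

omit [Fintype U] [Fintype B] in
theorem finite_blocks (hU : IsUnital J q) : Finite B := by
  have := hU.finite_points
  refine Finite.of_injective (fun b => {u | J u b}) fun b c hbc => ?_
  obtain ⟨u, hu, v, hv, huv⟩ := (Set.one_lt_ncard (s := {u | J u b})).1
    (by rw [hU.card_block]; have := hU.one_lt; lia)
  have hbc : ∀ w, J w b ↔ J w c := Set.ext_iff.1 hbc
  exact hU.block_eq huv hu hv ((hbc u).1 hu) ((hbc v).1 hv)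

omit [Fintype U] [Fintype B] in
theorem finite_of_isContainedIn_flip (hU : IsUnital J q) {D X : Type*} {I : D → X → Prop}
    (h : IsContainedIn (flip I) J) : Finite D := by
  obtain ⟨_, g, _, hg, _⟩ := h
  have := hU.finite_blocks
  exact Finite.of_injective g hg

omit [Fintype U] [Fintype B] in
/-- A unital of order `q > 2` does not contain the dual of a geometry on at least `q ^ 2` points in
which any two points are joined and each line has at most `q + 1` points. -/
theorem not_isContainedIn_flip (hU : IsUnital J q) (hq : 2 < q) {D X : Type*} [Finite D]
    {I : D → X → Prop} (hjoin : ∀ d e, d ≠ e → ∃ x, I d x ∧ I e x) (hD : q ^ 2 ≤ Nat.card D)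
    (hline : ∀ x, {d | I d x}.ncard ≤ q + 1) : ¬ IsContainedIn (flip I) J := by
  classical
  rintro ⟨f, g, hf, hg, hfg⟩
  have := hU.finite_points
  have := hU.finite_blocks
  have := Fintype.ofFinite U
  have := Fintype.ofFinite B
  have := Fintype.ofFinite D
  rw [Nat.card_eq_fintype_card, ← card_univ] at hD
  obtain ⟨T, -, hT⟩ := exists_subset_card_eq hD
  refine hU.false_of_clique (S := T.image g) hq ?_ (by rw [card_image_of_injective _ hg, hT]) ?_
  · intro b hb c hc hbc
    obtain ⟨d, -, rfl⟩ := mem_image.1 hb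
    obtain ⟨e, -, rfl⟩ := mem_image.1 hc
    obtain ⟨x, hx, hx'⟩ := hjoin d e fun h => hbc (h ▸ rfl)
    exact ⟨f x, hfg x d hx, hfg x e hx'⟩
  · intro u
    by_contra! hlt
    obtain ⟨b, hb, c, hc, hbc⟩ := one_lt_card.1
      (show 1 < #{b ∈ T.image g | J u b} from lt_of_le_of_lt (by lia) hlt)
    obtain ⟨hb, hub⟩ := mem_filter.1 hb
    obtain ⟨hc, huc⟩ := mem_filter.1 hc
    obtain ⟨d, -, rfl⟩ := mem_image.1 hb
    obtain ⟨e, -, rfl⟩ := mem_image.1 hc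
    -- Containment may create incidences, but a point on two image blocks is the image of the line
    -- joining their preimages. Injectivity of `f` makes this line the same for all blocks through
    -- `u`.
    have meet {d e : D} (hd : J u (g d)) (he : J u (g e)) (hde : d ≠ e) :
        ∃ x, I d x ∧ I e x ∧ f x = u := by
      obtain ⟨x, hx, hx'⟩ := hjoin d e hde
      refine ⟨x, hx, hx', ?_⟩
      by_contra hne
      exact hde (hg (hU.block_eq hne (hfg x d hx) hd (hfg x e hx') he))
    obtain ⟨x, hdx, -, hx⟩ := meet hub huc fun h => hbc (h ▸ rfl)
    refine (hline x).not_gt (hlt.trans_le ?_)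
    rw [Set.ncard_eq_toFinset_card', blockDegree, ← card_image_of_injective _ hg]
    refine card_le_card fun b hb => ?_
    obtain ⟨hb, hub'⟩ := mem_filter.1 hb
    obtain ⟨e', -, rfl⟩ := mem_image.1 hb
    refine mem_image_of_mem g ?_
    simp only [Set.mem_toFinset, Set.mem_ofPred_eq]
    by_cases hde : d = e'
    · exact hde ▸ hdx
    · obtain ⟨x', -, hx', hfx⟩ := meet hub hub' hde
      exact hf (hx.trans hfx.symm) ▸ hx'

end IsUnital

end Unital

/-! ### Affine planes and the three cases -/

/-- A finite affine plane of order `q` has at least `q ^ 2` points. -/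
theorem IsAffinePlaneOfOrder.sq_le_card {D X : Type*} [Finite D] {I : D → X → Prop} {q : ℕ}
    (hI : IsAffinePlaneOfOrder I q) : q ^ 2 ≤ Nat.card D := by
  classical
  have := Fintype.ofFinite D
  have hcard (l : X) : #{x | I x l} = q := by
    rw [← (hI.card_line l).2, Set.ncard_eq_toFinset_card']
    congr 1
    ext; simp
  have line_eq {x y : D} {l m : X} (hxy : x ≠ y) (hxl : I x l) (hyl : I y l) (hxm : I x m)
      (hym : I y m) : l = m :=
    (hI.existsUnique_line x y hxy).unique ⟨hxl, hyl⟩ ⟨hxm, hym⟩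
  obtain ⟨a, b, p, hab, -, -, htri⟩ := hI.exists_triangle
  obtain ⟨l, ⟨hal, hbl⟩, -⟩ := hI.existsUnique_line a b hab
  have hpl : ¬ I p l := fun h => htri l ⟨hal, hbl, h⟩
  have hex (x : D) (hx : I x l) : ∃ m, I p m ∧ I x m :=
    (hI.existsUnique_line p x fun h => hpl (h ▸ hx)).exists
  have : Nonempty X := ⟨l⟩
  choose! m hpm hxm using hex
  obtain ⟨m₀, ⟨hpm₀, hm₀⟩, -⟩ := hI.existsUnique_parallel p l hpl
  -- The lines through `p`: `q` joining it to `l` and one parallel, each with `q - 1` further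
  -- points, and `1 + (q + 1) * (q - 1) = q ^ 2`.
  let Λ : Finset X := insert m₀ (image m {x | I x l})
  have hΛ : #Λ = q + 1 := by
    rw [card_insert_of_notMem, card_image_of_injOn, hcard]
    · intro x hx y hy hxy
      have hx : I x l := by simpa using hx
      have hy : I y l := by simpa using hy
      by_contra hne
      exact hpl (line_eq hne (hxm x hx) (hxy ▸ hxm y hy) hx hy ▸ hpm x hx)
    · intro h
      obtain ⟨x, hx, rfl⟩ := mem_image.1 h
      have hx : I x l := by simpa using hx
      exact hm₀ x ⟨hx, hxm x hx⟩
  have hpΛ : ∀ k ∈ Λ, I p k := by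
    intro k hk
    rcases mem_insert.1 hk with rfl | hk
    · exact hpm₀
    · obtain ⟨x, hx, rfl⟩ := mem_image.1 hk
      exact hpm x (by simpa using hx)
  have hcount : #(Λ.biUnion fun k => ({x | I x k} : Finset D).erase p) = (q + 1) * (q - 1) := by
    rw [card_biUnion, sum_congr rfl fun k hk => ?_, sum_const, hΛ, smul_eq_mul]
    · rw [card_erase_of_mem (by simpa using hpΛ k hk), hcard]
    · intro k hk k' hk' hne
      refine disjoint_left.2 fun x hx hx' => hne ?_
      simp only [mem_erase, mem_filter, mem_univ, true_and] at hx hx'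
      exact line_eq hx.1 hx.2 (hpΛ k hk) hx'.2 (hpΛ k' hk')
  have hp : p ∉ Λ.biUnion fun k => ({x | I x k} : Finset D).erase p := by simp
  have := card_le_univ (insert p (Λ.biUnion fun k => ({x | I x k} : Finset D).erase p))
  rw [card_insert_of_notMem hp, hcount] at this
  rw [Nat.card_eq_fintype_card]
  rcases q with _ | q
  · simp
  · rw [Nat.add_sub_cancel] at this
    nlinarith

theorem corollary2p2 {U B : Type*} (J : U → B → Prop) (q : ℕ) (hq : 2 < q) (hU : IsUnital J q) :
    (∀ (D X : Type*) (I : D → X → Prop), IsLinearSpace I → Nat.card D = q ^ 2 →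
      (∀ l : X, {p : D | I p l}.ncard ≤ q + 1) → ¬ IsContainedIn (flip I) J) ∧
    (∀ (D X : Type*) (I : D → X → Prop), IsAffinePlaneOfOrder I q →
      ¬ IsContainedIn (flip I) J) ∧
    (∀ (P L : Type*) [Membership P L] [Configuration.ProjectivePlane P L],
      Configuration.ProjectivePlane.order P L = q →
      ¬ IsContainedIn (fun (p : P) (l : L) => p ∈ l) J) := by
  refine ⟨fun D X I hI hD hline h => ?_, fun D X I hI h => ?_, fun P L _ _ hord h => ?_⟩
  -- `Nat.card` is 0 on infinite types.
  · have := Nat.finite_of_card_ne_zero (α := D) (by rw [hD]; positivity)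
    exact hU.not_isContainedIn_flip hq (fun d e hde => (hI.existsUnique_line d e hde).exists)
      hD.ge hline h
  · have : Finite D := hU.finite_of_isContainedIn_flip h
    exact hU.not_isContainedIn_flip hq (fun d e hde => (hI.existsUnique_line d e hde).exists)
      hI.sq_le_card (fun l => by rw [(hI.card_line l).2]; lia) h
  · have : Finite L := hU.finite_of_isContainedIn_flip (I := fun (l : L) (p : P) => p ∈ l) h
    have : Finite P := by
      obtain ⟨f, -, hf, -⟩ := h
      have := hU.finite_points
      exact Finite.of_injective f hf
    have := Fintype.ofFinite L
    -- The plane is the dual of its dual, whose points are the `q ^ 2 + q + 1` lines in `L`.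
    refine hU.not_isContainedIn_flip hq (I := fun (l : L) (p : P) => p ∈ l)
      (fun l m hlm => ⟨_, Configuration.HasPoints.mkPoint_ax hlm⟩) ?_ (fun p => ?_) h
    · rw [Nat.card_eq_fintype_card, Configuration.ProjectivePlane.card_lines P L, hord]
      lia
    · rw [← hord, ← Configuration.ProjectivePlane.lineCount_eq L p]
      rfl
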